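/- A Moore push-down automaton (MPDA) is a tuple $\mathcal A=(Q,\Sigma,\Gamma,\delta,\tau,I,F)$ consisting of finite sets $Q$ (states), $\Sigma$ (input symbols) and $\Gamma$ (stack symbols), a set of transitions $$\delta\subseteq\bigl(Q\times\Gamma^{\le 1}\times\Gamma^{\le 1}\times Q\bigr)\setminus\bigl(Q\times\Gamma\times\Gamma\times Q\bigr),\qquad \Gamma^{\le 1}=\{\varepsilon\}\cup\Gamma,$$ an output function $\tau\colon Q\to\Sigma$, and sets $I,F\subseteq Q$ of initial and final states. A configuration is a pair $\langle q,\alpha\rangle\in Q\times\Gamma^*$. There is a move $\langle q,\gamma\alpha\rangle\vdash_{\mathcal A}\langle q',\gamma'\alpha\rangle$ whenever $(q,\gamma,\gamma',q')\in\delta$, $\alpha\in\Gamma^*$ and $\gamma\alpha\neq\varepsilon$, and there are no other moves. A configuration $\langle q,\alpha\rangle$ is initial if $q\in I$ and $\alpha\in\Gamma$ (exactly one stack symbol), and final if $q\in F$ and $\alpha=\varepsilon$. An accepting run is a sequence of configurations $\langle q_0,\alpha_0\rangle\vdash_{\mathcal A}\dotsb\vdash_{\mathcal A}\langle q_n,\alpha_n\rangle$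 whose first configuration is initial and whose last configuration is final. The language $L(\mathcal A)\subseteq\Sigma^*$ accepted by $\mathcal A$ is the set of all strings $\tau(q_0)\tau(q_1)\dotsm\tau(q_n)$ obtained from accepting runs. Theorem. Let $\Sigma$ be a finite alphabet and $L\subseteq\Sigma^*$. Then there is an MPDA $\mathcal A$ with input symbols $\Sigma$ and $L(\mathcal A)=L$ if and only if $L$ is context-free (that is, generated by a context-free grammar) and every string in $L$ has length at least $2$. -/

import Mathlib

/-- A Moore push-down automaton with states `Q`, input symbols `T` and stack symbols `Γ`
(finiteness of these types is imposed where the automaton is used).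
A string of length at most one over `Γ` is an element of `Option Γ`: `none` is the empty string.
A transition `(q, γ, γ', q')` removes `γ` from the top of the stack and puts `γ'` there. -/
structure MoorePDA (T Q Γ : Type*) where
  /-- The set of transitions. -/
  transitions : Set (Q × Option Γ × Option Γ × Q)
  /-- No transition both pops a symbol and pushes a symbol. -/
  not_pop_and_push : ∀ (q : Q) (γ γ' : Γ) (q' : Q), (q, some γ, some γ', q') ∉ transitions
  /-- The output function. -/
  output : Q → T
  /-- The set of initial states. -/
  initialStates : Set Q
  /-- The set of final states. -/
  finalStates : Set Q

namespace MoorePDA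

/-- One move between configurations; a configuration is a state together with the stack contents,
whose top is the head of the list. No move is possible once the stack is empty. -/
def Move {T Q Γ : Type*} (A : MoorePDA T Q Γ) (c c' : Q × List Γ) : Prop :=
  ∃ (q : Q) (γ γ' : Option Γ) (q' : Q) (α : List Γ),
    (q, γ, γ', q') ∈ A.transitions ∧ γ.toList ++ α ≠ [] ∧
      c = (q, γ.toList ++ α) ∧ c' = (q', γ'.toList ++ α)

/-- Initial configurations: an initial state and exactly one (arbitrary) symbol on the stack. -/
def IsInitial {T Q Γ : Type*} (A : MoorePDA T Q Γ) (c : Q × List Γ) : Prop :=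
  c.1 ∈ A.initialStates ∧ ∃ γ : Γ, c.2 = [γ]

/-- Final configurations: a final state and the empty stack. -/
def IsFinal {T Q Γ : Type*} (A : MoorePDA T Q Γ) (c : Q × List Γ) : Prop :=
  c.1 ∈ A.finalStates ∧ c.2 = []

/-- The nonempty sequence of configurations `c :: cs` is an accepting run. -/
def IsAcceptingRun {T Q Γ : Type*} (A : MoorePDA T Q Γ) (c : Q × List Γ)
    (cs : List (Q × List Γ)) : Prop :=
  A.IsInitial c ∧ List.IsChain A.Move (c :: cs) ∧
    A.IsFinal ((c :: cs).getLast (List.cons_ne_nil c cs))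

/-- The accepted language: the strings output, symbol by symbol, by the states attained during
an accepting run, including its first and its last state. -/
def language {T Q Γ : Type*} (A : MoorePDA T Q Γ) : Language T :=
  {w | ∃ (c : Q × List Γ) (cs : List (Q × List Γ)),
    A.IsAcceptingRun c cs ∧ w = (c :: cs).map fun d => A.output d.1}

end MoorePDA

universe u v w

/-! Both directions pass through finite systems of productions J → c l with at most two nonterminals
in l. From an automaton this is the triple construction: (p, γ, q) generates the outputs, except the
last, of runs from p to q that remove γ. Popping, staying and pushing leave 0, 1 and 2 nonterminals
(`Run.exists_path`, `Path.run`). Conversely, a state can hold the last letter and the leftmost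
nonterminal while the stack holds the others. Productions with 0, 1 and 2 nonterminals then pop,
stay and push, and none does both (`mem_language_ofGreibach`). For a grammar with start symbol S,
such a system comes from left-corner parsing: once the first letter c is read, the item ⟨[], c, S⟩
generates the rest of the word by climbing from the leaf c to the root S (`Yields.silentAccepts`,
`itemSound_of_greibachAccepts`). Moves that read nothing are absorbed into the letter productions
(`SilentAccepts.exists_greibachAccepts`). Length two is the exact bound: the initial stack is
nonempty, so a run makes a move; and a single nonterminal generates precisely a nonempty remainder
after the first letter. -/

/-! ### Leftmost derivations in systems of productions in Greibach form -/

/-- `GreibachAccepts R p w`: the list `p` of nonterminals derives the word `w` by means of the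
productions `J → c l` with `R J c l`. -/
inductive GreibachAccepts {T I : Type*} (R : I → T → List I → Prop) : List I → List T → Prop
  | nil : GreibachAccepts R [] []
  | cons {J : I} {c : T} {l p : List I} {w : List T} (h : R J c l)
      (hw : GreibachAccepts R (l ++ p) w) : GreibachAccepts R (J :: p) (c :: w)

namespace GreibachAccepts

variable {T I : Type*} {R : I → T → List I → Prop}

lemma append {p q : List I} {v w : List T} (hp : GreibachAccepts R p v)
    (hq : GreibachAccepts R q w) : GreibachAccepts R (p ++ q) (v ++ w) := by
  induction hp with
  | nil => simpa using hq
  | cons h _ ih => exact .cons h (by simpa using ih)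

/-- Allows an infinite set of nonterminals to be cut down to a finite one closed under the
productions. -/
lemma map_val_iff {F : Set I} (hF : ∀ J c l, R J c l → J ∈ F → ∀ x ∈ l, x ∈ F) {p : List F}
    {w : List T} : GreibachAccepts R (p.map Subtype.val) w ↔
      GreibachAccepts (fun (J : F) c (l : List F) => R J c (l.map Subtype.val)) p w := by
  constructor
  · generalize hq : p.map Subtype.val = q
    intro h
    induction h generalizing p with
    | nil =>
      obtain rfl := List.map_eq_nil_iff.1 hq
      exact .nil
    | @cons J c l q w h _ ih =>
      match p, hq with
      | K :: p, hq =>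
        simp only [List.map_cons, List.cons.injEq] at hq
        obtain ⟨rfl, rfl⟩ := hq
        lift l to List F using hF _ _ _ h K.2
        exact .cons h (ih (by simp))
  · intro h
    induction h with
    | nil => exact .nil
    | cons h _ ih => exact .cons h (by simpa using ih)

end GreibachAccepts

/-! ### Derivation trees of context-free grammars -/

namespace ContextFreeGrammar

variable {T : Type*}

/-- `g.Yields u w`: there is a forest of derivation trees of `g` with roots `u` and yield `w`. -/
inductive Yields (g : ContextFreeGrammar T) : List (Symbol T g.NT) → List T → Prop
  | nil : Yields g [] []
  | terminal (a : T) {u : List (Symbol T g.NT)} {w : List T} (h : Yields g u w) :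
      Yields g (.terminal a :: u) (a :: w)
  | rule {r : ContextFreeRule T g.NT} (hr : r ∈ g.rules) {v : List T}
      (hv : Yields g r.output v) {u : List (Symbol T g.NT)} {w : List T} (h : Yields g u w) :
      Yields g (.nonterminal r.input :: u) (v ++ w)

variable {g : ContextFreeGrammar T}

lemma Produces.of_mem {r : ContextFreeRule T g.NT} (hr : r ∈ g.rules) :
    g.Produces [.nonterminal r.input] r.output :=
  ⟨r, hr, .input_output⟩

lemma Derives.append {u u' v v' : List (Symbol T g.NT)} (h : g.Derives u u')
    (h' : g.Derives v v') : g.Derives (u ++ v) (u' ++ v') :=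
  (h.append_right v).trans (h'.append_left u')

lemma Yields.derives {u : List (Symbol T g.NT)} {w : List T} (h : g.Yields u w) :
    g.Derives u (w.map .terminal) := by
  induction h with
  | nil => rfl
  | terminal a _ ih => exact ih.append_left [_]
  | rule hr _ _ ihv ih =>
    rw [List.map_append]
    exact (((Produces.of_mem hr).trans_derives ihv).append ih :)

lemma Yields.append {u v : List (Symbol T g.NT)} {w x : List T} (h : g.Yields u w)
    (h' : g.Yields v x) : g.Yields (u ++ v) (w ++ x) := by
  induction h with
  | nil => exact h'
  | terminal a _ ih => exact .terminal a ih
  | rule hr hv _ _ ih => simpa using Yields.rule hr hv ih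

lemma Yields.exists_append {u v : List (Symbol T g.NT)} {w : List T} (h : g.Yields (u ++ v) w) :
    ∃ x y, w = x ++ y ∧ g.Yields u x ∧ g.Yields v y := by
  generalize hs : u ++ v = s at h
  induction h generalizing u with
  | nil =>
    obtain ⟨rfl, rfl⟩ := List.append_eq_nil_iff.1 hs
    exact ⟨[], [], rfl, .nil, .nil⟩
  | @terminal a s w h ih =>
    cases u with
    | nil =>
      obtain rfl : v = _ := hs
      exact ⟨[], _, rfl, .nil, .terminal a h⟩
    | cons b u =>
      obtain ⟨rfl, hs'⟩ := List.cons.inj hs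
      obtain ⟨x, y, rfl, hx, hy⟩ := ih hs'
      exact ⟨a :: x, y, rfl, .terminal a hx, hy⟩
  | @rule r hr z hz s w h _ ih =>
    cases u with
    | nil =>
      obtain rfl : v = _ := hs
      exact ⟨[], _, rfl, .nil, .rule hr hz h⟩
    | cons b u =>
      obtain ⟨rfl, hs'⟩ := List.cons.inj hs
      obtain ⟨x, y, rfl, hx, hy⟩ := ih hs'
      exact ⟨z ++ x, y, by simp, .rule hr hz hx, hy⟩

lemma Yields.map_terminal (w : List T) : g.Yields (w.map .terminal) w := by
  induction w with
  | nil => exact .nil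
  | cons a w ih => exact .terminal a ih

lemma Yields.of_produces {u v : List (Symbol T g.NT)} {w : List T} (h : g.Produces u v)
    (hv : g.Yields v w) : g.Yields u w := by
  obtain ⟨r, hr, h⟩ := h
  obtain ⟨p, q, rfl, rfl⟩ := h.exists_parts
  obtain ⟨x, z, rfl, hx, hz⟩ := hv.exists_append
  obtain ⟨x, y, rfl, hx, hy⟩ := hx.exists_append
  simpa using hx.append (Yields.rule hr hy hz)

lemma yields_iff_derives {u : List (Symbol T g.NT)} {w : List T} :
    g.Yields u w ↔ g.Derives u (w.map .terminal) := by
  refine ⟨Yields.derives, fun h => ?_⟩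
  induction h using Relation.ReflTransGen.head_induction_on with
  | refl => exact .map_terminal w
  | head h _ ih => exact ih.of_produces h

end ContextFreeGrammar

/-! ### From Greibach productions to context-free grammars -/

section GreibachGrammar

variable {T : Type*}

/-- The start productions `start` and the Greibach productions `R` as context-free rules with
start symbol `s`, where `φ` embeds the nonterminals. -/
inductive IsGreibachRule {I N : Type*} (s : N) (φ : I → N) (start : List I → Prop)
    (R : I → T → List I → Prop) : ContextFreeRule T N → Prop
  | start {l : List I} (h : start l) :
      IsGreibachRule s φ start R ⟨s, l.map fun J => .nonterminal (φ J)⟩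
  | step {J : I} {c : T} {l : List I} (h : R J c l) :
      IsGreibachRule s φ start R ⟨φ J, .terminal c :: l.map fun J => .nonterminal (φ J)⟩

lemma Symbol.finite (T N : Type*) [Finite T] [Finite N] : Finite (Symbol T N) := by
  refine Finite.of_surjective (Sum.elim Symbol.terminal Symbol.nonterminal : T ⊕ N → _) ?_
  rintro (a | a)
  exacts [⟨.inl a, rfl⟩, ⟨.inr a, rfl⟩]

section

variable {I : Type*} {start : List I → Prop} {R : I → T → List I → Prop}

lemma finite_setOf_isGreibachRule {N : Type*} [Finite T] [Finite N] (s : N) (φ : I → N)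
    (hs : ∀ l, start l → l.length ≤ 2) (hR : ∀ J c l, R J c l → l.length ≤ 2) :
    {r | IsGreibachRule s φ start R r}.Finite := by
  have := Symbol.finite T N
  -- The bound 3 counts one letter and two nonterminals.
  refine ((Set.finite_univ.prod (List.finite_length_le (Symbol T N) 3)).image
    fun x : N × List (Symbol T N) => ContextFreeRule.mk x.1 x.2).subset ?_
  rintro _ (@⟨l, h⟩ | @⟨J, c, l, h⟩)
  · exact ⟨(_, _), ⟨trivial, by simpa using (hs l h).trans (by simp)⟩, rfl⟩
  · exact ⟨(_, _), ⟨trivial, by simpa [Nat.lt_succ_iff] using hR J c l h⟩, rfl⟩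

variable {g : ContextFreeGrammar T} {φ : I → g.NT}

/-- The second conjunct makes the induction work: the body of a production starts with a letter, so
the subtree below a nonterminal has this other shape. -/
lemma greibachAccepts_of_yields (hφ : Function.Injective φ) (hφs : ∀ J, φ J ≠ g.initial)
    (hg : ∀ r ∈ g.rules, IsGreibachRule g.initial φ start R r)
    {u : List (Symbol T g.NT)} {w : List T} (h : g.Yields u w) :
    (∀ p : List I, u = (p.map fun J => .nonterminal (φ J)) → GreibachAccepts R p w) ∧
    (∀ (c : T) (p : List I), u = (.terminal c :: p.map fun J => .nonterminal (φ J)) →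
      ∃ w', w = c :: w' ∧ GreibachAccepts R p w') := by
  induction h with
  | nil =>
    refine ⟨fun p hp => ?_, by simp⟩
    obtain rfl : p = [] := by simpa using hp.symm
    exact .nil
  | terminal a h ih =>
    refine ⟨fun p hp => ?_, fun c p hp => ?_⟩
    · cases p <;> simp at hp
    · obtain ⟨ha, hp'⟩ := List.cons.inj hp
      cases ha
      exact ⟨_, rfl, ih.1 p hp'⟩
  | @rule r hr v hv u w h ihv ih =>
    refine ⟨fun p hp => ?_, by simp⟩
    cases p with
    | nil => simp at hp
    | cons J p =>
      obtain ⟨hJ, hp'⟩ := List.cons.inj hp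
      obtain @⟨l, hl⟩ | @⟨K, c, l, hl⟩ := hg r hr
      · exact absurd (Symbol.nonterminal.inj hJ).symm (hφs J)
      · obtain rfl := hφ (Symbol.nonterminal.inj hJ)
        obtain ⟨w', rfl, hw'⟩ := ihv.2 c l rfl
        exact .cons hl (hw'.append (ih.1 p hp'))

lemma yields_of_greibachAccepts (hg : ∀ r, IsGreibachRule g.initial φ start R r → r ∈ g.rules)
    {p : List I} {w : List T} (h : GreibachAccepts R p w) :
    g.Yields (p.map fun J => .nonterminal (φ J)) w := by
  induction h with
  | nil => exact .nil
  | @cons J c l p w h _ ih =>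
    rw [List.map_append] at ih
    obtain ⟨x, y, rfl, hx, hy⟩ := ih.exists_append
    exact .rule (r := ⟨φ J, _⟩) (hg _ (.step h)) (.terminal c hx) hy

/-- The start symbol is not in the range of `φ`, so it occurs in no rule body and a start rule is
used only at the root. -/
lemma yields_initial_iff (hφ : Function.Injective φ) (hφs : ∀ J, φ J ≠ g.initial)
    (hg : ∀ r, r ∈ g.rules ↔ IsGreibachRule g.initial φ start R r) {w : List T} :
    g.Yields [.nonterminal g.initial] w ↔ ∃ l, start l ∧ GreibachAccepts R l w := by
  constructor
  · generalize hu : [Symbol.nonterminal g.initial] = u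
    intro h
    cases h with
    | nil => simp at hu
    | terminal a h => simp at hu
    | @rule r hr v hv u w h =>
      obtain ⟨hr', rfl⟩ := List.cons.inj hu
      cases h
      obtain @⟨l, hl⟩ | @⟨J, c, l, hl⟩ := (hg r).1 hr
      · exact ⟨l, hl, by
          simpa using (greibachAccepts_of_yields hφ hφs (fun r => (hg r).1) hv).1 l rfl⟩
      · exact absurd (Symbol.nonterminal.inj hr').symm (hφs J)
  · rintro ⟨l, hl, h⟩
    simpa using ContextFreeGrammar.Yields.rule (r := ⟨g.initial, _⟩) ((hg _).2 (.start hl))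
      (yields_of_greibachAccepts (fun r => (hg r).2) h) .nil

end

theorem isContextFree_setOf_greibachAccepts [Finite T] {I : Type} [Finite I]
    {start : List I → Prop} {R : I → T → List I → Prop} (hs : ∀ l, start l → l.length ≤ 2)
    (hR : ∀ J c l, R J c l → l.length ≤ 2) :
    Language.IsContextFree ({w | ∃ l, start l ∧ GreibachAccepts R l w} : Language T) := by
  refine ⟨⟨Option I, none, (finite_setOf_isGreibachRule none some hs hR).toFinset⟩,
    Set.ext fun w => ContextFreeGrammar.yields_iff_derives.symm.trans ?_⟩
  exact yields_initial_iff (φ := some) (Option.some_injective I) (by simp) (by simp)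

end GreibachGrammar

/-! ### Runs of Moore push-down automata -/

namespace MoorePDA

variable {T Q Γ Q' Γ' : Type*}

/-- `A.Run c w`: some run from `c` to a final configuration outputs `w`. -/
inductive Run (A : MoorePDA T Q Γ) : Q × List Γ → List T → Prop
  | final {c : Q × List Γ} (h : A.IsFinal c) : Run A c [A.output c.1]
  | move {c c' : Q × List Γ} {w : List T} (h : A.Move c c') (hw : Run A c' w) :
      Run A c (A.output c.1 :: w)

variable {A : MoorePDA T Q Γ}

lemma run_iff {c : Q × List Γ} {w : List T} :
    A.Run c w ↔ ∃ cs, List.IsChain A.Move (c :: cs) ∧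
      A.IsFinal ((c :: cs).getLast (List.cons_ne_nil c cs)) ∧
      w = (c :: cs).map fun d => A.output d.1 := by
  constructor
  · intro h
    induction h with
    | final h => exact ⟨[], by simp, by simpa using h, rfl⟩
    | @move c c' w h _ ih =>
      obtain ⟨cs, h1, h2, rfl⟩ := ih
      exact ⟨c' :: cs, by simp [h, h1], by simpa using h2, by simp⟩
  · rintro ⟨cs, h1, h2, rfl⟩
    induction cs generalizing c with
    | nil => exact .final (by simpa using h2)
    | cons d cs ih =>
      rw [List.isChain_cons_cons] at h1
      exact .move h1.1 (ih h1.2 (by simpa using h2))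

lemma mem_language_iff {w : List T} : w ∈ A.language ↔ ∃ c, A.IsInitial c ∧ A.Run c w := by
  simp only [run_iff]
  constructor
  · rintro ⟨c, cs, ⟨h1, h2, h3⟩, h4⟩
    exact ⟨c, h1, cs, h2, h3, h4⟩
  · rintro ⟨c, h1, cs, h2, h3, h4⟩
    exact ⟨c, cs, ⟨h1, h2, h3⟩, h4⟩

lemma two_le_length_of_mem_language {w : List T} (hw : w ∈ A.language) : 2 ≤ w.length := by
  obtain ⟨c, ⟨_, γ, hγ⟩, h⟩ := mem_language_iff.1 hw
  cases h with
  | final h => simp [h.2] at hγ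
  | move _ h => cases h <;> simp

/-- Renaming of the states and of the stack symbols. -/
def rename (A : MoorePDA T Q Γ) (e : Q' ≃ Q) (f : Γ' ≃ Γ) : MoorePDA T Q' Γ' where
  transitions := {t | (e t.1, t.2.1.map f, t.2.2.1.map f, e t.2.2.2) ∈ A.transitions}
  not_pop_and_push _ _ _ _ := A.not_pop_and_push _ _ _ _
  output q := A.output (e q)
  initialStates := e ⁻¹' A.initialStates
  finalStates := e ⁻¹' A.finalStates

lemma rename_rename_symm (A : MoorePDA T Q Γ) (e : Q' ≃ Q) (f : Γ' ≃ Γ) :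
    (A.rename e f).rename e.symm f.symm = A := by
  simp [rename, Set.preimage_preimage]

lemma language_rename_subset (A : MoorePDA T Q Γ) (e : Q' ≃ Q) (f : Γ' ≃ Γ) {w : List T}
    (hw : w ∈ (A.rename e f).language) : w ∈ A.language := by
  rw [mem_language_iff] at hw ⊢
  obtain ⟨c, ⟨h1, γ, h2⟩, h⟩ := hw
  refine ⟨(e c.1, c.2.map f), ⟨h1, f γ, by simp [h2]⟩, ?_⟩
  clear h1 h2
  induction h with
  | final h => exact .final (c := (_, _)) ⟨h.1, by simp [h.2]⟩
  | move h _ ih =>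
    refine .move (c := (_, _)) ?_ ih
    obtain ⟨q, γ, γ', q', α, h1, h2, rfl, rfl⟩ := h
    refine ⟨e q, γ.map f, γ'.map f, e q', α.map f, h1, ?_, ?_, ?_⟩
    · cases γ
      · simpa using h2
      · simp
    · cases γ <;> simp
    · cases γ' <;> simp

/-- Makes the universes of states and stack symbols irrelevant. The reverse inclusion is the same
inclusion for the inverse renaming. -/
lemma language_rename (A : MoorePDA T Q Γ) (e : Q' ≃ Q) (f : Γ' ≃ Γ) :
    (A.rename e f).language = A.language := by
  refine Set.Subset.antisymm (fun w => A.language_rename_subset e f) fun w hw => ?_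
  refine (A.rename e f).language_rename_subset e.symm f.symm ?_
  rwa [rename_rename_symm]

/-! ### From Moore push-down automata to Greibach productions -/

/-- The Greibach productions of an automaton. The nonterminal `inl (p, γ, q)` stands for the
outputs on the way from state `p` with `γ` on top of the stack to state `q` with `γ` removed,
the nonterminal `inr q` for the output of `q`. -/
inductive Production (A : MoorePDA T Q Γ) :
    (Q × Γ × Q) ⊕ Q → T → List ((Q × Γ × Q) ⊕ Q) → Prop
  | pop {p q : Q} {γ : Γ} (h : (p, some γ, none, q) ∈ A.transitions) :
      Production A (.inl (p, γ, q)) (A.output p) []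
  | stay {p p' q : Q} {γ : Γ} (h : (p, none, none, p') ∈ A.transitions) :
      Production A (.inl (p, γ, q)) (A.output p) [.inl (p', γ, q)]
  | push {p p' r q : Q} {γ γ' : Γ} (h : (p, none, some γ', p') ∈ A.transitions) :
      Production A (.inl (p, γ, q)) (A.output p) [.inl (p', γ', r), .inl (r, γ, q)]
  | last (q : Q) : Production A (.inr q) (A.output q) []

/-- The lists of nonterminals which describe the ways to a final configuration. -/
inductive Path (A : MoorePDA T Q Γ) : Q → List Γ → List ((Q × Γ × Q) ⊕ Q) → Prop
  | nil {p : Q} (h : p ∈ A.finalStates) : Path A p [] [.inr p]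
  | cons {p r : Q} {γ : Γ} {α : List Γ} {l : List ((Q × Γ × Q) ⊕ Q)} (h : Path A r α l) :
      Path A p (γ :: α) (.inl (p, γ, r) :: l)

/-- A path guesses, for each stack symbol, the state reached on its removal. Induction from the end
of the run supplies these guesses. -/
lemma Run.exists_path {c : Q × List Γ} {w : List T} (h : A.Run c w) :
    ∃ l, A.Path c.1 c.2 l ∧ GreibachAccepts A.Production l w := by
  induction h with
  | @final c h =>
    obtain ⟨q, α⟩ := c
    obtain ⟨h, rfl : α = []⟩ := h
    exact ⟨_, .nil h, .cons (.last q) .nil⟩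
  | move h _ ih =>
    obtain ⟨l, hl, hw⟩ := ih
    obtain ⟨q, γ, γ', q', α, h1, h2, rfl, rfl⟩ := h
    match γ, γ' with
    | some γ, some γ' => exact (A.not_pop_and_push _ _ _ _ h1).elim
    | some γ, none => exact ⟨_, .cons hl, .cons (.pop h1) hw⟩
    | none, none =>
      cases α with
      | nil => simp at h2
      | cons γ₀ α =>
        cases hl with
        | cons hl => exact ⟨_, .cons hl, .cons (.stay h1) hw⟩
    | none, some γ' =>
      cases α with
      | nil => simp at h2
      | cons γ α =>
        cases hl with
        | cons hl =>
          cases hl with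
          | cons hl => exact ⟨_, .cons hl, .cons (.push h1) hw⟩

lemma Path.run {l : List ((Q × Γ × Q) ⊕ Q)} {w : List T}
    (hw : GreibachAccepts A.Production l w) {p : Q} {α : List Γ} (hl : A.Path p α l) :
    A.Run (p, α) w := by
  induction hw generalizing p α with
  | nil => cases hl
  | @cons J c l l' w h hw ih =>
    cases h with
    | pop h =>
      cases hl with
      | cons hl => exact .move ⟨_, _, _, _, _, h, by simp, rfl, rfl⟩ (ih hl)
    | stay h =>
      cases hl with
      | cons hl =>
        exact .move ⟨_, _, _, _, _ :: _, h, by simp, rfl, rfl⟩ (ih (.cons hl))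
    | push h =>
      cases hl with
      | cons hl =>
        exact .move ⟨_, _, _, _, _ :: _, h, by simp, rfl, rfl⟩ (ih (.cons (.cons hl)))
    | last q =>
      cases hl with
      | nil h =>
        cases hw
        exact .final ⟨h, rfl⟩

lemma isContextFree_language_of_type [Finite T] {Q Γ : Type} [Finite Q] [Finite Γ]
    (A : MoorePDA T Q Γ) : A.language.IsContextFree := by
  have h : A.language = {w | ∃ l, (∃ p ∈ A.initialStates, ∃ γ, A.Path p [γ] l) ∧
      GreibachAccepts A.Production l w} := by
    refine Set.ext fun w => mem_language_iff.trans ⟨?_, ?_⟩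
    · rintro ⟨⟨q, _⟩, ⟨h, γ, rfl⟩, hw⟩
      obtain ⟨l, hl, hw⟩ := hw.exists_path
      exact ⟨l, ⟨q, h, γ, hl⟩, hw⟩
    · rintro ⟨l, ⟨q, h, γ, hl⟩, hw⟩
      exact ⟨_, ⟨h, γ, rfl⟩, hl.run hw⟩
  rw [h]
  refine isContextFree_setOf_greibachAccepts ?_ ?_
  -- A one-symbol stack gives two nonterminals: one for the symbol, one for the output of the last
  -- state.
  · rintro l ⟨p, hp, γ, _ | ⟨_ | _⟩⟩
    simp
  · rintro J c l (_ | _ | _ | _) <;> simp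

theorem isContextFree_language [Finite T] [Finite Q] [Finite Γ] (A : MoorePDA T Q Γ) :
    A.language.IsContextFree := by
  rw [← A.language_rename (Finite.equivFin Q).symm (Finite.equivFin Γ).symm]
  exact isContextFree_language_of_type _

/-! ### From Greibach productions to Moore push-down automata -/

/-- The transitions of `ofGreibach`. -/
inductive GreibachTransition {I : Type*} (R : I → T → List I → Prop) :
    (T × Option I) × Option (Option I) × Option (Option I) × (T × Option I) → Prop
  | pop {J : I} {c' : T} (h : R J c' []) (c : T) (Z : Option I) :
      GreibachTransition R ((c, some J), some Z, none, (c', Z))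
  | stay {J K : I} {c' : T} (h : R J c' [K]) (c : T) :
      GreibachTransition R ((c, some J), none, none, (c', some K))
  | push {J K K' : I} {c' : T} (h : R J c' [K, K']) (c : T) :
      GreibachTransition R ((c, some J), none, some (some K'), (c', some K))

/-- The automaton which keeps the last letter and the leftmost nonterminal in its state and the
other nonterminals on its stack, above the bottom symbol `none`. -/
def ofGreibach {I : Type*} (R : I → T → List I → Prop) (start : T → I → Prop) :
    MoorePDA T (T × Option I) (Option I) where
  transitions := {t | GreibachTransition R t}
  not_pop_and_push _ _ _ _ := by rintro ⟨⟩
  output := Prod.fst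
  initialStates := {q | ∃ J, start q.1 J ∧ q.2 = some J}
  finalStates := {q | q.2 = none}

section

variable {I : Type*} {R : I → T → List I → Prop} {start : T → I → Prop}

/-- The initial stack symbol is arbitrary; it is the final configuration, traced backwards, that
forces `none` to be the bottom symbol and to occur nowhere else. -/
lemma Run.exists_greibachAccepts {d : (T × Option I) × List (Option I)} {w : List T}
    (h : (ofGreibach R start).Run d w) :
    ∃ p v, d.1.2 :: d.2 = p.map some ++ [none] ∧ w = d.1.1 :: v ∧ GreibachAccepts R p v := by
  induction h with
  | @final d h =>
    obtain ⟨⟨c, Z⟩, α⟩ := d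
    obtain ⟨rfl : Z = none, rfl : α = []⟩ := h
    exact ⟨[], [], rfl, rfl, .nil⟩
  | move h _ ih =>
    obtain ⟨p, v, hp, rfl, hv⟩ := ih
    obtain ⟨q, γ, γ', q', α, h1, h2, rfl, rfl⟩ := h
    cases h1 with
    | @pop J c' h c Z =>
      exact ⟨J :: p, _, by simpa using hp, rfl, .cons h hv⟩
    | @stay J K c' h c =>
      cases p with
      | nil => simp at hp
      | cons K p =>
        simp only [Option.toList_none, List.nil_append, List.map_cons, List.cons_append,
          List.cons.injEq, Option.some.injEq] at hp
        obtain ⟨rfl, rfl⟩ := hp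
        exact ⟨J :: p, _, by simp, rfl, .cons h hv⟩
    | @push J K K' c' h c =>
      match p with
      | [] => simp at hp
      | [K] => simp at hp
      | K :: K' :: p =>
        simp only [Option.toList_some, List.cons_append, List.nil_append, List.map_cons,
          List.cons.injEq, Option.some.injEq] at hp
        obtain ⟨rfl, rfl, rfl⟩ := hp
        exact ⟨J :: p, _, by simp, rfl, .cons h hv⟩

lemma run_of_greibachAccepts (hR : ∀ J c l, R J c l → l.length ≤ 2) {p : List I} {v : List T}
    (h : GreibachAccepts R p v) (c : T) {Z : Option I} {α : List (Option I)}
    (hp : Z :: α = p.map some ++ [none]) : (ofGreibach R start).Run ((c, Z), α) (c :: v) := by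
  induction h generalizing c Z α with
  | nil =>
    obtain ⟨rfl, rfl⟩ : Z = none ∧ α = [] := by simpa using hp
    exact .final ⟨rfl, rfl⟩
  | @cons J c' l p v h _ ih =>
    obtain ⟨rfl, rfl⟩ : Z = some J ∧ α = p.map some ++ [none] := by simpa using hp
    match l, hR _ _ _ h with
    | [], _ =>
      -- The bottom symbol guarantees that there is something to pop, even when no nonterminal
      -- remains.
      obtain ⟨Z, α, hα⟩ : ∃ Z α, p.map some ++ [none] = Z :: α :=
        List.exists_cons_of_ne_nil (by simp)
      rw [hα]
      exact .move ⟨_, _, _, _, _, .pop h c Z, by simp, rfl, rfl⟩ (ih c' (by simpa using hα.symm))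
    | [K], _ =>
      exact .move ⟨_, _, _, _, p.map some ++ [none], .stay h c, by simp, rfl, rfl⟩
        (ih c' (by simp))
    | [K, K'], _ =>
      exact .move ⟨_, _, _, _, p.map some ++ [none], .push h c, by simp, rfl, rfl⟩
        (ih c' (by simp))

theorem mem_language_ofGreibach (hR : ∀ J c l, R J c l → l.length ≤ 2) {w : List T} :
    w ∈ (ofGreibach R start).language ↔
      ∃ c J v, w = c :: v ∧ start c J ∧ GreibachAccepts R [J] v := by
  rw [mem_language_iff]
  constructor
  · rintro ⟨⟨⟨c, _⟩, _⟩, ⟨⟨J, hJ, rfl⟩, Z, rfl⟩, h⟩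
    obtain ⟨p, v, hp, rfl, hv⟩ := h.exists_greibachAccepts
    match p with
    | [] => simp at hp
    | [K] =>
      obtain ⟨rfl, -⟩ : J = K ∧ Z = none := by simpa using hp
      exact ⟨c, J, v, rfl, hJ, hv⟩
    | K :: K' :: p => simp at hp
  · rintro ⟨c, J, v, rfl, hJ, hv⟩
    exact ⟨((c, some J), [none]), ⟨⟨J, hJ, rfl⟩, none, rfl⟩, run_of_greibachAccepts hR hv c rfl⟩

end

end MoorePDA

/-! ### Removal of silent moves -/

section Silent

variable {T I : Type*} (silent : I → I → Prop) (emit : I → T → I → I → Prop) (done : I → Prop)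

/-- Acceptance of a word by a list of items: the first item may be replaced silently, be removed
when it is done, or emit a letter and be replaced by two items. -/
inductive SilentAccepts : List I → List T → Prop
  | nil : SilentAccepts [] []
  | done {J : I} {p : List I} {w : List T} (h : done J) (hw : SilentAccepts p w) :
      SilentAccepts (J :: p) w
  | silent {J K : I} {p : List I} {w : List T} (h : silent J K) (hw : SilentAccepts (K :: p) w) :
      SilentAccepts (J :: p) w
  | emit {J K K' : I} {c : T} {p : List I} {w : List T} (h : emit J c K K')
      (hw : SilentAccepts (K :: K' :: p) w) : SilentAccepts (J :: p) (c :: w)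

/-- The items which accept the empty word. -/
def Erasable (J : I) : Prop :=
  ∃ K, Relation.ReflTransGen silent J K ∧ done K

/-- `DropErasable p q`: the list `q` results from `p` by omitting some erasable items. -/
inductive DropErasable : List I → List I → Prop
  | nil : DropErasable [] []
  | keep {J : I} {p q : List I} (h : DropErasable p q) : DropErasable (J :: p) (J :: q)
  | drop {J : I} {p q : List I} (hJ : Erasable silent done J) (h : DropErasable p q) :
      DropErasable (J :: p) q

/-- The productions obtained by removal of silent moves. -/
def SilentFree (J : I) (c : T) (l : List I) : Prop :=
  ∃ J' K K', Relation.ReflTransGen silent J J' ∧ emit J' c K K' ∧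
    DropErasable silent done [K, K'] l

variable {silent emit done}

lemma DropErasable.append {p p' q q' : List I} (h : DropErasable silent done p q)
    (h' : DropErasable silent done p' q') : DropErasable silent done (p ++ p') (q ++ q') := by
  induction h with
  | nil => exact h'
  | keep _ ih => exact .keep ih
  | drop hJ _ ih => exact .drop hJ ih

lemma DropErasable.exists_append {p p' q : List I} (h : DropErasable silent done (p ++ p') q) :
    ∃ r r', q = r ++ r' ∧ DropErasable silent done p r ∧ DropErasable silent done p' r' := by
  induction p generalizing q with
  | nil => exact ⟨[], q, rfl, .nil, h⟩
  | cons J p ih =>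
    cases h with
    | keep h =>
      obtain ⟨r, r', rfl, hr, hr'⟩ := ih h
      exact ⟨J :: r, r', rfl, .keep hr, hr'⟩
    | drop hJ h =>
      obtain ⟨r, r', rfl, hr, hr'⟩ := ih h
      exact ⟨r, r', rfl, .drop hJ hr, hr'⟩

lemma DropErasable.refl (p : List I) : DropErasable silent done p p := by
  induction p with
  | nil => exact .nil
  | cons J p ih => exact .keep ih

lemma DropErasable.length_le {p q : List I} (h : DropErasable silent done p q) :
    q.length ≤ p.length := by
  induction h with
  | nil => rfl
  | keep _ ih => simpa using ih
  | drop _ _ ih => exact ih.trans (by simp)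

lemma DropErasable.subset {p q : List I} (h : DropErasable silent done p q) : q ⊆ p := by
  induction h with
  | nil => simp
  | keep _ ih => exact List.cons_subset_cons _ ih
  | drop _ _ ih => exact List.subset_cons_of_subset _ ih

lemma SilentFree.length_le {J : I} {c : T} {l : List I} (h : SilentFree silent emit done J c l) :
    l.length ≤ 2 := by
  obtain ⟨_, _, _, _, _, h⟩ := h
  exact h.length_le

/-- A silent move at an item that is kept lengthens the silent chain in its production; at an
omitted item it lengthens the chain showing that it is erasable. -/
lemma SilentAccepts.exists_greibachAccepts {p : List I} {w : List T}
    (h : SilentAccepts silent emit done p w) : ∃ q, DropErasable silent done p q ∧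
      GreibachAccepts (SilentFree silent emit done) q w := by
  induction h with
  | nil => exact ⟨[], .nil, .nil⟩
  | done h _ ih =>
    obtain ⟨q, hq, hw⟩ := ih
    exact ⟨q, .drop ⟨_, .refl, h⟩ hq, hw⟩
  | silent h _ ih =>
    obtain ⟨q, hq, hw⟩ := ih
    cases hq with
    | keep hq =>
      cases hw with
      | cons hR hw =>
        obtain ⟨J', K, K', h1, h2, h3⟩ := hR
        exact ⟨_, .keep hq, .cons ⟨J', K, K', h1.head h, h2, h3⟩ hw⟩
    | drop hK hq =>
      obtain ⟨K', hK, hK'⟩ := hK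
      exact ⟨q, .drop ⟨K', hK.head h, hK'⟩ hq, hw⟩
  | @emit J K K' c p w h _ ih =>
    obtain ⟨q, hq, hw⟩ := ih
    obtain ⟨l, q, rfl, hl, hq⟩ := DropErasable.exists_append (p := [K, K']) hq
    exact ⟨_, .keep hq, .cons ⟨J, K, K', .refl, h, hl⟩ hw⟩

/-- Every predicate which is closed under the moves of the items holds for the accepted words. -/
lemma GreibachAccepts.forall₂_of_silentFree {S : I → List T → Prop} (hdone : ∀ J, done J → S J [])
    (hsilent : ∀ J K w, silent J K → S K w → S J w)
    (hemit : ∀ J c K K' v w, emit J c K K' → S K v → S K' w → S J (c :: (v ++ w)))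
    {p : List I} {w : List T} (h : GreibachAccepts (SilentFree silent emit done) p w) :
    ∃ ws : List (List T), w = ws.flatten ∧ List.Forall₂ S p ws := by
  have hsilent' {J K : I} (h : Relation.ReflTransGen silent J K) {w : List T} (hw : S K w) :
      S J w := by
    induction h using Relation.ReflTransGen.head_induction_on with
    | refl => exact hw
    | head h _ ih => exact hsilent _ _ _ h ih
  -- Omitted items are reinstated with the empty word.
  have hdrop {q l : List I} (h : DropErasable silent done q l) :
      ∀ ws, List.Forall₂ S l ws →
        ∃ ws' : List (List T), ws'.flatten = ws.flatten ∧ List.Forall₂ S q ws' := by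
    induction h with
    | nil => exact fun ws h => ⟨ws, rfl, h⟩
    | keep _ ih =>
      rintro _ (_ | ⟨h, hws⟩)
      obtain ⟨ws', h1, h2⟩ := ih _ hws
      exact ⟨_ :: ws', by simp [h1], .cons h h2⟩
    | drop hJ _ ih =>
      intro ws hws
      obtain ⟨ws', h1, h2⟩ := ih _ hws
      obtain ⟨K, hK, hd⟩ := hJ
      exact ⟨[] :: ws', by simp [h1], .cons (hsilent' hK (hdone K hd)) h2⟩
  induction h with
  | nil => exact ⟨[], rfl, .nil⟩
  | @cons J c l p w h _ ih =>
    obtain ⟨ws, rfl, hws⟩ := ih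
    obtain ⟨J', K, K', h1, h2, h3⟩ := h
    obtain ⟨ws', h4, _ | ⟨hK, _ | ⟨hK', hws'⟩⟩⟩ :=
      hdrop (h3.append (.refl p)) ws hws
    exact ⟨_ :: _, by simp [← h4], .cons (hsilent' h1 (hemit _ _ _ _ _ _ h2 hK hK')) hws'⟩

end Silent

/-! ### Left-corner parsing -/

namespace ContextFreeGrammar

variable {T : Type*} (g : ContextFreeGrammar T)

/-- The item `⟨β, X, A⟩` describes a node `X` on the leftmost branch of a derivation tree with root
`A`, where the children `β` of `X` have not yet been parsed. -/
structure Item where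
  /-- The symbols below `parent` still to be parsed. -/
  rest : List (Symbol T g.NT)
  /-- The current node on the leftmost branch. -/
  parent : Symbol T g.NT
  /-- The root of the tree. -/
  root : Symbol T g.NT

/-- The moves of the left-corner parser which read no letter. -/
inductive ItemSilent : g.Item → g.Item → Prop
  | skip {V X A : Symbol T g.NT} {β : List (Symbol T g.NT)} (h : g.Yields [V] []) :
      ItemSilent ⟨V :: β, X, A⟩ ⟨β, X, A⟩
  | climb {r : ContextFreeRule T g.NT} (hr : r ∈ g.rules) {α β : List (Symbol T g.NT)}
      {Y A : Symbol T g.NT} (h : r.output = α ++ Y :: β) (hα : g.Yields α []) :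
      ItemSilent ⟨[], Y, A⟩ ⟨β, .nonterminal r.input, A⟩

/-- The moves of the left-corner parser which read a letter. -/
inductive ItemEmit : g.Item → T → g.Item → g.Item → Prop
  | mk (V X A : Symbol T g.NT) (β : List (Symbol T g.NT)) (c : T) :
      ItemEmit ⟨V :: β, X, A⟩ c ⟨[], .terminal c, V⟩ ⟨β, X, A⟩

/-- The items of completely parsed trees. -/
def ItemDone (J : g.Item) : Prop :=
  J.rest = [] ∧ J.parent = J.root

variable {g}

/-- The two conjuncts are proved together. The first parses α top-down as pending children; the
second starts at the leaf c, the left corner of α, and climbs to the parent of α, with γ the erased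
siblings on the left. -/
lemma Yields.silentAccepts {α : List (Symbol T g.NT)} {v : List T} (h : g.Yields α v) :
    (∀ (β : List (Symbol T g.NT)) (X A : Symbol T g.NT) (p : List g.Item) (z : List T),
      SilentAccepts g.ItemSilent g.ItemEmit g.ItemDone (⟨β, X, A⟩ :: p) z →
      SilentAccepts g.ItemSilent g.ItemEmit g.ItemDone (⟨α ++ β, X, A⟩ :: p) (v ++ z)) ∧
    ∀ (c : T) (w : List T), v = c :: w → ∀ r ∈ g.rules, ∀ γ, r.output = γ ++ α → g.Yields γ [] →
      ∀ (A : Symbol T g.NT) (p : List g.Item) (z : List T),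
      SilentAccepts g.ItemSilent g.ItemEmit g.ItemDone (⟨[], .nonterminal r.input, A⟩ :: p) z →
      SilentAccepts g.ItemSilent g.ItemEmit g.ItemDone (⟨[], .terminal c, A⟩ :: p) (w ++ z) := by
  induction h with
  | nil => simp
  | @terminal a u w h ih =>
    refine ⟨fun β X A p z hz => ?_, ?_⟩
    · exact .emit (.mk _ _ _ _ _) (.done ⟨rfl, rfl⟩ (ih.1 _ _ _ _ _ hz))
    · rintro c w ⟨⟩ r hr γ hγ hγ0 A p z hz
      refine .silent (.climb hr hγ hγ0) ?_
      simpa using ih.1 [] _ _ _ _ hz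
  | @rule r hr v hv u w h ihv ih =>
    refine ⟨fun β X A p z hz => ?_, ?_⟩
    · have hz := ih.1 _ _ _ _ _ hz
      cases v with
      | nil => exact .silent (.skip (.rule hr hv .nil)) hz
      | cons c v =>
        simp only [List.cons_append, List.append_assoc]
        exact .emit (.mk _ _ _ _ _) (ihv.2 c v rfl r hr [] rfl .nil _ _ _ (.done ⟨rfl, rfl⟩ hz))
    · intro c w' hw' r' hr' γ hγ hγ0 A p z hz
      cases v with
      | nil =>
        -- A child with empty yield joins the erased siblings γ.
        exact ih.2 c w' hw' r' hr' (γ ++ [.nonterminal r.input]) (by simpa using hγ)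
          (hγ0.append (.rule hr hv .nil)) A p z hz
      | cons c v =>
        obtain ⟨rfl, rfl⟩ := List.cons.inj hw'
        change SilentAccepts _ _ _ _ (v ++ w ++ z)
        rw [List.append_assoc]
        -- The climb goes from c to `r.input`, then to its parent `r'.input`.
        refine ihv.2 _ v rfl r hr [] rfl .nil _ _ _ (.silent (.climb hr' hγ hγ0) ?_)
        simpa using ih.1 [] _ _ _ _ hz

lemma Yields.silentAccepts_root {c : T} {w : List T} {A : g.NT}
    (h : g.Yields [.nonterminal A] (c :: w)) :
    SilentAccepts g.ItemSilent g.ItemEmit g.ItemDone [⟨[], .terminal c, .nonterminal A⟩] w := by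
  generalize hu : [Symbol.nonterminal A] = u, hv : c :: w = v at h
  cases h with
  | nil => simp at hu
  | terminal a h => simp at hu
  | @rule r hr v hv' u w' h =>
    obtain ⟨hr', rfl⟩ := List.cons.inj hu
    cases h
    rw [hr']
    simpa using hv'.silentAccepts.2 c w (by simpa using hv.symm) r hr [] rfl .nil _ _ _
      (.done ⟨rfl, rfl⟩ .nil)

/-- The words which lead from the item `J` to a completely parsed tree. -/
def ItemSound (J : g.Item) (w : List T) : Prop :=
  ∀ s, g.Derives [J.parent] (s ++ J.rest) → g.Derives [J.root] (s ++ w.map .terminal)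

/-- `ItemSound` is closed under the parser moves. It quantifies over the parsed part s because
climbing changes the parent while s remains the same. -/
lemma itemSound_of_greibachAccepts {J : g.Item} {w : List T}
    (h : GreibachAccepts (SilentFree g.ItemSilent g.ItemEmit g.ItemDone) [J] w) :
    ItemSound J w := by
  suffices H : ∃ ws : List (List T), w = ws.flatten ∧ List.Forall₂ ItemSound [J] ws by
    obtain ⟨ws, rfl, _ | ⟨hw, _ | _⟩⟩ := H
    simpa using hw
  refine h.forall₂_of_silentFree ?_ ?_ ?_
  · rintro J ⟨h1, h2⟩ s hs
    rw [h1, h2] at hs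
    simpa using hs
  · rintro _ _ w (@⟨V, X, A, β, h⟩ | @⟨r, hr, α, β, Y, A, h, hα⟩) hw s hs
    · refine hw s (hs.trans ?_)
      simpa using (h.derives.append_right β).append_left s
    · refine hw s ((Produces.of_mem hr).trans_derives ?_)
      rw [h]
      simpa using hα.derives.append (hs.append_right β)
  · rintro _ c _ _ v w ⟨V, X, A, β⟩ hv hw s hs
    have h := hw (s ++ .terminal c :: v.map .terminal) (hs.trans ?_)
    · simpa using h
    · simpa using ((hv [.terminal c] (by simp; rfl)).append_right β).append_left s

/-- The items whose symbols occur in the grammar. -/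
def itemSet (g : ContextFreeGrammar T) : Set g.Item :=
  {J | J.rest ∈ {β | β = [] ∨ ∃ r ∈ g.rules, β <:+ r.output} ∧
    J.parent ∈ {X | (∃ c, X = .terminal c) ∨ ∃ r ∈ g.rules, X = .nonterminal r.input} ∧
    J.root ∈ {A | A = .nonterminal g.initial ∨ ∃ r ∈ g.rules, A ∈ r.output}}

/-- `g.NT` may be infinite; finiteness comes from the finitely many rules and letters. -/
lemma finite_itemSet [Finite T] : g.itemSet.Finite := by
  have h1 : {β : List (Symbol T g.NT) | β = [] ∨ ∃ r ∈ g.rules, β <:+ r.output}.Finite := by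
    refine ((Set.finite_singleton []).union
      (g.rules.finite_toSet.biUnion fun r _ => (r.output.tails.finite_toSet))).subset ?_
    rintro β (rfl | ⟨r, hr, h⟩)
    · simp
    · exact .inr (Set.mem_biUnion hr (by simpa using h))
  have h2 : {X : Symbol T g.NT | (∃ c, X = .terminal c) ∨
      ∃ r ∈ g.rules, X = .nonterminal r.input}.Finite := by
    refine ((Set.finite_range Symbol.terminal).union
      (g.rules.finite_toSet.image fun r => Symbol.nonterminal r.input)).subset ?_
    rintro _ (⟨c, rfl⟩ | ⟨r, hr, rfl⟩)
    · exact .inl ⟨c, rfl⟩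
    · exact .inr ⟨r, hr, rfl⟩
  have h3 : {A : Symbol T g.NT | A = .nonterminal g.initial ∨
      ∃ r ∈ g.rules, A ∈ r.output}.Finite := by
    refine ((Set.finite_singleton (Symbol.nonterminal g.initial)).union
      (g.rules.finite_toSet.biUnion fun r _ => (r.output.finite_toSet))).subset ?_
    rintro A (rfl | ⟨r, hr, h⟩)
    · simp
    · exact .inr (Set.mem_biUnion hr h)
  refine ((h1.prod (h2.prod h3)).image fun x => ⟨x.1, x.2.1, x.2.2⟩).subset ?_
  rintro ⟨β, X, A⟩ h
  exact ⟨(β, X, A), ⟨h.1, h.2.1, h.2.2⟩, rfl⟩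

lemma ItemSilent.mem_itemSet {J K : g.Item} (h : g.ItemSilent J K) (hJ : J ∈ g.itemSet) :
    K ∈ g.itemSet := by
  obtain ⟨h1, h2, h3⟩ := hJ
  obtain @⟨V, X, A, β, h⟩ | @⟨r, hr, α, β, Y, A, h, hα⟩ := h
  · refine ⟨.inr ?_, h2, h3⟩
    obtain h | ⟨r, hr, h⟩ := h1
    · simp at h
    · exact ⟨r, hr, (List.suffix_cons V β).trans h⟩
  · exact ⟨.inr ⟨r, hr, α ++ [Y], by simp [h]⟩, .inr ⟨r, hr, rfl⟩, h3⟩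

lemma ItemEmit.mem_itemSet {J K K' : g.Item} {c : T} (h : g.ItemEmit J c K K')
    (hJ : J ∈ g.itemSet) : K ∈ g.itemSet ∧ K' ∈ g.itemSet := by
  obtain ⟨h1, h2, h3⟩ := hJ
  obtain ⟨V, X, A, β⟩ := h
  obtain h | ⟨r, hr, h⟩ := h1
  · simp at h
  · exact ⟨⟨.inl rfl, .inl ⟨c, rfl⟩, .inr ⟨r, hr, h.subset (by simp)⟩⟩,
      .inr ⟨r, hr, (List.suffix_cons V β).trans h⟩, h2, h3⟩

lemma mem_itemSet_of_silentFree {J : g.Item} {c : T} {l : List g.Item}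
    (h : SilentFree g.ItemSilent g.ItemEmit g.ItemDone J c l) (hJ : J ∈ g.itemSet) :
    ∀ K ∈ l, K ∈ g.itemSet := by
  obtain ⟨J', K, K', h1, h2, h3⟩ := h
  have hJ' : J' ∈ g.itemSet := by
    clear h2
    induction h1 with
    | refl => exact hJ
    | tail _ h ih => exact h.mem_itemSet ih
  obtain ⟨hK, hK'⟩ := h2.mem_itemSet hJ'
  intro L hL
  obtain rfl | rfl : L = K ∨ L = K' := by simpa using h3.subset hL
  exacts [hK, hK']

/-- Fails for empty w: the grammar may generate c alone, but a nonempty list of nonterminals never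
derives the empty word. -/
lemma mem_language_iff_greibachAccepts {c : T} {w : List T} (hw : w ≠ []) :
    c :: w ∈ g.language ↔ GreibachAccepts (SilentFree g.ItemSilent g.ItemEmit g.ItemDone)
      [⟨[], .terminal c, .nonterminal g.initial⟩] w := by
  rw [mem_language_iff, ← yields_iff_derives]
  constructor
  · intro h
    obtain ⟨q, hq, h⟩ := h.silentAccepts_root.exists_greibachAccepts
    cases hq with
    | keep hq =>
      cases hq
      exact h
    | drop _ hq =>
      cases hq
      cases h
      exact absurd rfl hw
  · intro h
    rw [yields_iff_derives]
    exact itemSound_of_greibachAccepts h [.terminal c] (by simp; rfl)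

theorem exists_moorePDA {T : Type u} [Finite T] (g : ContextFreeGrammar T)
    (hg : ∀ w ∈ g.language, 2 ≤ w.length) :
    ∃ (I : Type u) (_ : Finite I) (A : MoorePDA T (T × Option I) (Option I)),
      A.language = g.language := by
  refine ⟨g.itemSet, finite_itemSet, .ofGreibach
    (fun J c l => SilentFree g.ItemSilent g.ItemEmit g.ItemDone J.1 c (l.map Subtype.val))
    (fun c J => J.1 = ⟨[], .terminal c, .nonterminal g.initial⟩), ?_⟩
  ext w
  have hF : ∀ J c l, SilentFree g.ItemSilent g.ItemEmit g.ItemDone J c l → J ∈ g.itemSet →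
      ∀ K ∈ l, K ∈ g.itemSet := fun _ _ _ => mem_itemSet_of_silentFree
  rw [MoorePDA.mem_language_ofGreibach fun J c l h => by simpa using h.length_le]
  constructor
  · rintro ⟨c, J, v, rfl, hJ, h⟩
    rw [← GreibachAccepts.map_val_iff hF] at h
    refine (mem_language_iff_greibachAccepts ?_).2 (by simpa [hJ] using h)
    rintro rfl
    cases h
  · intro hw
    match w, hg w hw with
    | c :: d :: v, _ =>
      refine ⟨c, ⟨_, .inl rfl, .inl ⟨c, rfl⟩, .inl rfl⟩, d :: v, rfl, rfl, ?_⟩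
      rw [← GreibachAccepts.map_val_iff hF]
      exact (mem_language_iff_greibachAccepts (by simp)).1 hw

end ContextFreeGrammar

theorem mainTheorem7 {T : Type u} [Finite T] (L : Language T) :
    (∃ (Q : Type v) (Γ : Type w) (_ : Finite Q) (_ : Finite Γ) (A : MoorePDA T Q Γ),
      A.language = L) ↔
    L.IsContextFree ∧ ∀ x ∈ L, 2 ≤ x.length := by
  constructor
  · rintro ⟨Q, Γ, _, _, A, rfl⟩
    exact ⟨A.isContextFree_language, fun x => MoorePDA.two_le_length_of_mem_language⟩
  · rintro ⟨⟨g, rfl⟩, hg⟩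
    obtain ⟨I, _, A, hA⟩ := g.exists_moorePDA hg
    -- Lifted copies of `Fin n` place states and stack symbols in the prescribed universes.
    refine ⟨ULift (Fin (Nat.card (T × Option I))), ULift (Fin (Nat.card (Option I))),
      inferInstance, inferInstance, A.rename (Equiv.ulift.trans (Finite.equivFin _).symm)
        (Equiv.ulift.trans (Finite.equivFin _).symm), ?_⟩
    rw [MoorePDA.language_rename, hA]
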